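/- **Corollary 2.3.** In the deterministic LOCAL model, an $n$-vertex simple graph is a network in which every vertex initially knows $n$, its degree and its own identifier; the identifiers are distinct integers in $\{1,\dots,B(n)\}$, where $B(n)\ge n$ (for instance $B(n)$ is a polynomial in $n$), and each vertex numbers its incident edges arbitrarily. All vertices run the same deterministic algorithm. In each synchronous round every vertex sends a message of arbitrary size to each of its neighbours, receives the messages sent to it, and performs an arbitrary local computation; eventually every vertex irrevocably outputs $0$ or $1$, its side of a cut. The size of a cut is the number of edges whose ends are on different sides. For $\alpha>0$, the algorithm is an $\alpha$-approximation of MaxCut on general graphs running in $T(n)$ rounds if for every $n$, every $n$-vertex simple graph, every admissible assignment of identifiers and every numbering of the incident edges, all vertices have produced their output after at most $T(n)$ rounds, and the resulting cut has size at least $\alpha$ times the maximum size of a cut of the graph. Let $\log^* x=0$ for $x\le 1$ and $\log^* x=1+\log^*(\log_2 x)$ for $x>1$. For every $\alpha>0$ there exist a constant $c>0$ and an integer $N$, depending only on $\alpha$, such that for every $B:\mathbb{N}\to\mathbb{N}$ with $B(n)\ge n$ for all $n$, every deterministic $\alpha$-approximation algorithm for MaxCut on general graphs in the LOCAL model with identifiers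 in $\{1,\dots,B(n)\}$ that runs in $T(n)$ rounds satisfies $T(n)\ge c\,\log^* n$ for all $n\ge N$. That is, deterministic constant-factor approximation of MaxCut on general graphs in the LOCAL model requires $\Omega(\log^* n)$ rounds. -/

import Mathlib

/-! ### Iterated logarithm -/

/-- The iterated base 2 logarithm `log* x`: the number of times `log₂` has to be applied, starting
from `x`, before the value is at most `1`. -/
noncomputable def logStar (x : ℝ) : ℕ :=
  sInf {k : ℕ | (Real.logb 2)^[k] x ≤ 1}

theorem logStar_of_le_one {x : ℝ} (hx : x ≤ 1) : logStar x = 0 := by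
  unfold logStar
  rw [Nat.sInf_eq_zero]
  left
  simpa using hx

theorem exists_iterate_logb_le_one (x : ℝ) : ∃ k : ℕ, (Real.logb 2)^[k] x ≤ 1 := by
  have key : ∀ m : ℕ, ∀ y : ℝ, y ≤ m → ∃ k : ℕ, (Real.logb 2)^[k] y ≤ 1 := by
    intro m
    induction m with
    | zero => intro y hy; exact ⟨0, by simpa using hy.trans (by norm_num)⟩
    | succ m ih =>
      intro y hy
      by_cases h1 : y ≤ 1
      · exact ⟨0, by simpa using h1⟩
      · rw [not_le] at h1
        by_cases h2 : y ≤ 2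
        · refine ⟨1, ?_⟩
          rw [Function.iterate_one, Real.logb_le_iff_le_rpow (by norm_num) (by linarith)]
          simpa using h2
        · have hm : Real.logb 2 y ≤ m := by
            rw [Real.logb_le_iff_le_rpow (by norm_num) (by linarith), Real.rpow_natCast]
            have h3 : m + 1 ≤ 2 ^ m := Nat.lt_two_pow_self
            have h4 : ((m + 1 : ℕ) : ℝ) ≤ ((2 ^ m : ℕ) : ℝ) := by exact_mod_cast h3
            push_cast at h4 hy
            linarith
          obtain ⟨k, hk⟩ := ih _ hm
          exact ⟨k + 1, by rw [Function.iterate_succ_apply]; exact hk⟩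
  obtain ⟨m, hm⟩ := exists_nat_ge x
  exact key m x hm

/-- The usual recursion for the iterated logarithm. -/
theorem logStar_of_one_lt {x : ℝ} (hx : 1 < x) : logStar x = 1 + logStar (Real.logb 2 x) := by
  have h := Nat.sInf_add (n := 1) (p := fun k : ℕ => (Real.logb 2)^[k] x ≤ 1) (by
    have h1 : sInf {k : ℕ | (Real.logb 2)^[k] x ≤ 1} ∈ {k : ℕ | (Real.logb 2)^[k] x ≤ 1} :=
      Nat.sInf_mem (exists_iterate_logb_le_one x)
    rcases Nat.eq_zero_or_pos (sInf {k : ℕ | (Real.logb 2)^[k] x ≤ 1}) with h0 | h0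
    · rw [h0] at h1
      exact absurd h1 (by simpa using hx)
    · exact h0)
  unfold logStar
  rw [← h, add_comm]
  rfl

/-! ### Cuts -/

/-- The size of the cut given by `side`: the number of edges of `G` whose two ends are on different
sides. -/
noncomputable def cutSize {n : ℕ} (G : SimpleGraph (Fin n)) (side : Fin n → Bool) : ℕ :=
  {e : Sym2 (Fin n) | e ∈ G.edgeSet ∧ ∃ u v, e = s(u, v) ∧ side u ≠ side v}.ncard

/-- The maximum size of a cut of `G`. -/
noncomputable def maxCut {n : ℕ} (G : SimpleGraph (Fin n)) : ℕ :=
  (Finset.univ : Finset (Fin n → Bool)).sup (cutSize G)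

/-! ### The LOCAL model -/

/-- An `n`-node communication network: a finite simple graph whose nodes carry pairwise distinct
identifiers, and in which every node `v` numbers its incident edges by ports `0, …, deg v - 1`. -/
structure Network (n : ℕ) where
  graph : SimpleGraph (Fin n)
  ident : Fin n → ℕ
  ident_injective : Function.Injective ident
  port : ∀ v : Fin n, Fin (graph.neighborSet v).ncard ≃ graph.neighborSet v

namespace Network

variable {n : ℕ} (net : Network n)

/-- The degree of a node. -/
noncomputable def deg (v : Fin n) : ℕ := (net.graph.neighborSet v).ncard

/-- The neighbour of `v` behind port `i`. -/
def neighbor (v : Fin n) (i : Fin (net.deg v)) : Fin n := (net.port v i : Fin n)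

/-- The number of the port through which the neighbour of `v` behind port `i` of `v` reaches `v`. -/
def backPort (v : Fin n) (i : Fin (net.deg v)) : ℕ :=
  ((net.port (net.neighbor v i)).symm
    ⟨v, SimpleGraph.Adj.symm (net.port v i).property⟩ : Fin _)

end Network

/-- A deterministic distributed algorithm in the LOCAL model, whose nodes have to output one bit.
All nodes run the same algorithm; local computations and the size of messages are unrestricted.
* `init n i d` is the initial state of a node with identifier `i` and degree `d` in an `n`-node
  network;
* `send s p` is the message that a node in state `s` sends through its port `p`;
* `recv s d m` is the new state of a node of degree `d` in state `s` that receives the message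
  `m p` through each of its ports `p`;
* `output s` is the bit output by a node in state `s`, if it has already produced its output;
  an output is final. -/
structure LocalAlgorithm where
  State : Type
  Msg : Type
  init : (n i d : ℕ) → State
  send : State → ℕ → Msg
  recv : State → (d : ℕ) → (Fin d → Msg) → State
  output : State → Option Bool
  output_final : ∀ (s : State) (b : Bool) (d : ℕ) (m : Fin d → Msg),
    output s = some b → output (recv s d m) = some b

namespace LocalAlgorithm

/-- The state of every node after `t` synchronous rounds of communication. In a round, each node
sends one message to each of its neighbours, receives the messages that its neighbours sent to it,
and updates its state. -/
noncomputable def stateAfter (A : LocalAlgorithm) {n : ℕ} (net : Network n) : ℕ → Fin n → A.State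
  | 0, v => A.init n (net.ident v) (net.deg v)
  | t + 1, v => A.recv (A.stateAfter net t v) (net.deg v)
      (fun i => A.send (A.stateAfter net t (net.neighbor v i)) (net.backPort v i))

/-- `A` is an `α`-approximation algorithm for MaxCut on general graphs which runs in `T n` rounds on
`n`-vertex graphs, when the identifiers are distinct integers between `1` and `B n`: for every
`n`-vertex graph, every such assignment of identifiers and every port numbering, after `T n` rounds
all nodes have output their side of the cut, and the size of this cut is at least `α` times the
maximum size of a cut. -/
def ApproximatesMaxCut (A : LocalAlgorithm) (B T : ℕ → ℕ) (α : ℝ) : Prop :=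
  ∀ (n : ℕ) (net : Network n), (∀ v, 1 ≤ net.ident v ∧ net.ident v ≤ B n) →
    ∃ side : Fin n → Bool,
      (∀ v, A.output (A.stateAfter net (T n) v) = some (side v)) ∧
      α * (maxCut net.graph : ℝ) ≤ (cutSize net.graph side : ℝ)

end LocalAlgorithm

/-! On an oriented cycle, `t` rounds amount to a 2-colouring `χ` of windows of `2 * t + 1`
consecutive identifiers. The adversary orders the identifiers `1, …, n` around the cycle so that
most adjacent nodes get the same output, which leaves few cut edges, whereas an optimal cut of a
cycle has at least `n - 1`.

Such an order comes from a Linial-type bound on proper colourings of increasing windows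
(`card_le_tower_of_proper_coloring`). It implies that every set of identifiers larger than a tower
of height `2 * t` contains a long increasing list whose windows all have one colour
(`exists_windowsMono`). Peeling off such lists until few identifiers remain, and concatenating them,
gives the order (`exists_list_many_goodPositions`). A constant ratio therefore forces `n` below a
tower of height `O(t)`, that is, `log* n = O(t + 1)`. -/

/-- Exponential tower of `j` twos topped by `x`. -/
def tower (j x : ℕ) : ℕ := (fun y => 2 ^ y)^[j] x

@[simp] theorem tower_zero (x : ℕ) : tower 0 x = x := rfl

theorem tower_succ (j x : ℕ) : tower (j + 1) x = 2 ^ tower j x :=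
  Function.iterate_succ_apply' _ _ _

theorem tower_succ' (j x : ℕ) : tower (j + 1) x = tower j (2 ^ x) :=
  Function.iterate_succ_apply _ _ _

theorem tower_add (i j x : ℕ) : tower (i + j) x = tower i (tower j x) :=
  Function.iterate_add_apply _ _ _ _

theorem tower_mono (j : ℕ) {x y : ℕ} (h : x ≤ y) : tower j x ≤ tower j y := by
  induction j with
  | zero => simpa
  | succ j ih => rw [tower_succ, tower_succ]; exact Nat.pow_le_pow_right (by norm_num) ih

theorem le_tower (j x : ℕ) : x ≤ tower j x := by
  induction j with
  | zero => simp
  | succ j ih => rw [tower_succ]; exact ih.trans Nat.lt_two_pow_self.le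

theorem le_tower_one (x : ℕ) : x ≤ tower x 1 := by
  induction x with
  | zero => simp
  | succ x ih =>
    rw [tower_succ]
    exact (Nat.succ_le_succ ih).trans Nat.lt_two_pow_self

/-- A factor passes below each exponential, since `M * 2 ^ y ≤ 2 ^ (M - 1 + y) ≤ 2 ^ (M * y)` for `y
≥ 1`. -/
theorem mul_tower_le {M x : ℕ} (hM : 1 ≤ M) (hx : 1 ≤ x) (j : ℕ) :
    M * tower j x ≤ tower j (M * x) := by
  induction j with
  | zero => simp
  | succ j ih =>
    rw [tower_succ, tower_succ]
    refine le_trans ?_ (Nat.pow_le_pow_right (by norm_num) ih)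
    have h1 : 1 ≤ tower j x := hx.trans (le_tower j x)
    obtain ⟨r, rfl⟩ := Nat.exists_eq_add_of_le' hM
    have h2 : r + 1 ≤ 2 ^ r := Nat.lt_two_pow_self
    calc (r + 1) * 2 ^ tower j x ≤ 2 ^ r * 2 ^ tower j x := Nat.mul_le_mul_right _ h2
      _ = 2 ^ (r + tower j x) := (pow_add _ _ _).symm
      _ ≤ _ := Nat.pow_le_pow_right (by norm_num) (by nlinarith)

theorem logStar_le_iff (x : ℝ) (j : ℕ) : logStar x ≤ j ↔ x ≤ (tower j 1 : ℕ) := by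
  induction j generalizing x with
  | zero =>
    rcases le_or_gt x 1 with h | h
    · simp [logStar_of_le_one h, h]
    · simp [logStar_of_one_lt h, h]
  | succ j ih =>
    rcases le_or_gt x 1 with h | h
    · have h1 : (1 : ℝ) ≤ (tower (j + 1) 1 : ℕ) := by exact_mod_cast le_tower (j + 1) 1
      simp [logStar_of_le_one h, h.trans h1]
    · rw [logStar_of_one_lt h, add_comm 1, Nat.add_le_add_iff_right, ih, tower_succ,
        Real.logb_le_iff_le_rpow (by norm_num) (by linarith), Real.rpow_natCast]
      push_cast
      rfl

/-! ### Colourings of increasing windows -/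

/-- Shortening windows by one entry costs one exponential in the number of colours: a shorter window
is coloured by the set of colours of its right extensions. For windows of one entry the colouring is
injective on `R`. -/
theorem card_le_tower_of_proper_coloring (R : Finset ℕ) (k : ℕ) :
    ∀ (κ : Type) [Fintype κ] (c : List ℕ → κ),
      (∀ a l b, l.length = k → (a :: (l ++ [b])).Pairwise (· < ·) → (∀ x ∈ a :: (l ++ [b]), x ∈ R) →
        c (a :: l) ≠ c (l ++ [b])) → R.card ≤ tower k (Fintype.card κ) := by
  induction k with
  | zero =>
    intro κ _ c hc
    have key : ∀ a ∈ R, ∀ b ∈ R, a < b → c [a] ≠ c [b] := fun a ha b hb hab => by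
      simpa using hc a [] b rfl (by simpa using hab) (by simp [ha, hb])
    refine Finset.card_le_card_of_injOn (t := Finset.univ) (fun a => c [a]) (by simp) ?_
    intro a ha b hb hab
    by_contra hne
    rcases lt_or_gt_of_ne hne with h | h
    · exact key a ha b hb h hab
    · exact key b hb a ha h hab.symm
  | succ k ih =>
    intro κ _ c hc
    classical
    have := ih (Set κ) (fun l => {z | ∃ y, (l ++ [y]).Pairwise (· < ·) ∧
      (∀ x ∈ l ++ [y], x ∈ R) ∧ c (l ++ [y]) = z}) ?_
    · rwa [Fintype.card_set, ← tower_succ'] at this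
    -- If the two sets agree, the colour of `a :: (l ++ [b])` also occurs on some `l ++ [b, y]`, the
    -- window right after it, contradicting properness.
    · intro a l b hl hp hR heq
      have hmem : c (a :: (l ++ [b])) ∈ {z | ∃ y, ((a :: l) ++ [y]).Pairwise (· < ·) ∧
        (∀ x ∈ (a :: l) ++ [y], x ∈ R) ∧ c ((a :: l) ++ [y]) = z} := ⟨b, hp, hR, rfl⟩
      rw [heq] at hmem
      obtain ⟨y, hy1, hy2, hy3⟩ := hmem
      refine hc a (l ++ [b]) y (by simp [hl]) ?_ ?_ hy3.symm
      · rw [List.pairwise_cons]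
        refine ⟨fun x hx => ?_, hy1⟩
        rw [List.pairwise_cons] at hp
        rcases List.mem_append.1 hx with h | h
        · exact hp.1 x h
        · rw [List.mem_singleton.1 h]
          exact (hp.1 b (by simp)).trans ((List.pairwise_append.1 hy1).2.2 b (by simp) y (by simp))
      · intro x hx
        rcases List.mem_cons.1 hx with h | h
        · exact hR x (by simp [h])
        · exact hy2 x h

/-- All windows of length `k` of the list `q` have colour `col`. -/
def WindowsMono (χ : List ℕ → Bool) (k : ℕ) (col : Bool) (q : List ℕ) : Prop :=
  ∀ u w v, q = u ++ w ++ v → w.length = k → χ w = col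

/-- Otherwise, pairing `χ` with the length of the longest monochromatic extension to the left gives
a proper colouring with `2 * L` colours. -/
theorem exists_windowsMono (χ : List ℕ → Bool) (R : Finset ℕ) (k L : ℕ)
    (hL : 0 < L) (hR : tower k (2 * L) < R.card) :
    ∃ q : List ℕ, q.length = L + k ∧ q.Pairwise (· < ·) ∧ (∀ x ∈ q, x ∈ R) ∧
      ∃ col, WindowsMono χ (k + 1) col q := by
  classical
  by_contra hno
  push Not at hno
  let P : List ℕ → ℕ → Prop := fun l j => ∃ p : List ℕ, p.length = j ∧ (p ++ l).Pairwise (· < ·) ∧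
    (∀ x ∈ p ++ l, x ∈ R) ∧ WindowsMono χ (k + 1) (χ l) (p ++ l)
  -- An extension by `L - 1` or more entries contains a forbidden list, namely its last `L + k`
  -- entries.
  have hshort : ∀ l : List ℕ, l.length = k + 1 → ∀ j, P l j → j + 1 < L := by
    rintro l hl j ⟨p, hp, h1, h2, h3⟩
    by_contra hj
    rw [not_lt] at hj
    have hd : (p ++ l).drop (j + 1 - L) <:+ p ++ l := List.drop_suffix _ _
    refine hno ((p ++ l).drop (j + 1 - L)) ?_ (h1.sublist hd.sublist)
      (fun x hx => h2 x (hd.subset hx)) (χ l) ?_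
    · rw [List.length_drop, List.length_append]; omega
    · intro u w v huv hw
      refine h3 ((p ++ l).take (j + 1 - L) ++ u) w v ?_ hw
      conv_lhs => rw [← List.take_append_drop (j + 1 - L) (p ++ l), huv]
      simp
  let h : List ℕ → ℕ := fun l => Nat.findGreatest (P l) L
  have key := card_le_tower_of_proper_coloring R k (Bool × Fin L)
  -- The reduction mod `L` only makes the colour total; on the windows that matter `h l < L`
  -- already.
  have hlt : ∀ l, h l % L < L := fun l => Nat.mod_lt _ hL
  refine absurd (key (fun l => (χ l, ⟨h l % L, hlt l⟩)) ?_) (by simpa using hR)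
  intro a l b hl hp hRm heq
  simp only [Prod.mk.injEq, Fin.mk.injEq] at heq
  obtain ⟨hχ, hh⟩ := heq
  have hbase : P (a :: l) 0 := by
    refine ⟨[], rfl, ?_, ?_, ?_⟩
    · exact hp.sublist (List.Sublist.cons_cons _ (List.sublist_append_left _ _))
    · intro x hx; exact hRm x (by simp at hx ⊢; tauto)
    · intro u w v huv hw
      have h4 := congrArg List.length huv
      simp [hl, hw] at h4
      have hu : u = [] := List.eq_nil_of_length_eq_zero (by omega)
      have hv : v = [] := List.eq_nil_of_length_eq_zero (by omega)
      subst hu hv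
      simp at huv
      rw [huv]
  have hP : P (a :: l) (h (a :: l)) := Nat.findGreatest_spec (Nat.zero_le L) hbase
  -- When two consecutive windows share a colour, any extension of the first, followed by `a`,
  -- extends the second, so `h` strictly increases.
  have hP' : P (l ++ [b]) (h (a :: l) + 1) := by
    obtain ⟨p, hp1, hp2, hp3, hp4⟩ := hP
    have e : p ++ [a] ++ (l ++ [b]) = p ++ a :: l ++ [b] := by simp
    refine ⟨p ++ [a], by simp [hp1], ?_, ?_, ?_⟩
    · rw [e, List.pairwise_append]
      refine ⟨hp2, by simp, ?_⟩
      intro x hx y hy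
      rw [List.mem_singleton.1 hy]
      rw [List.pairwise_cons] at hp
      have hab := hp.1 b (by simp)
      rcases List.mem_append.1 hx with hx | hx
      · exact ((List.pairwise_append.1 hp2).2.2 x hx a (by simp)).trans hab
      · rcases List.mem_cons.1 hx with rfl | hx
        · exact hab
        · exact (List.pairwise_append.1 hp.2).2.2 x hx b (by simp)
    · intro x hx
      rw [e] at hx
      rcases List.mem_append.1 hx with hx | hx
      · exact hp3 x hx
      · exact hRm x (by simp at hx; simp [hx])
    · intro u w v huv hw
      rcases List.eq_nil_or_concat v with rfl | ⟨v', z, rfl⟩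
      · rw [List.append_nil] at huv
        rw [(List.append_inj' huv (by simp [hl, hw])).2]
      · rw [e, List.concat_eq_append, ← List.append_assoc] at huv
        rw [← hχ]
        exact hp4 u w v' (List.append_inj' huv rfl).1 hw
  have hb1 := hshort (a :: l) (by simp [hl]) _ hP
  have hb2 := hshort (l ++ [b]) (by simp [hl]) _ hP'
  have hle : h (a :: l) + 1 ≤ h (l ++ [b]) := Nat.le_findGreatest (by omega) hP'
  have hP'' : P (l ++ [b]) (h (l ++ [b])) := Nat.findGreatest_spec (m := h (a :: l) + 1) (by omega) hP'
  have hb3 := hshort (l ++ [b]) (by simp [hl]) _ hP''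
  rw [Nat.mod_eq_of_lt (by omega), Nat.mod_eq_of_lt (by omega)] at hh
  omega

/-! ### Orderings with many equally coloured consecutive windows -/

/-- The positions of `l` at which two consecutive windows of length `k` have the same colour. -/
def goodPositions (χ : List ℕ → Bool) (k : ℕ) (l : List ℕ) : Finset ℕ :=
  (Finset.range l.length).filter fun s =>
    s + k < l.length ∧ χ ((l.drop s).take k) = χ ((l.drop (s + 1)).take k)

theorem card_goodPositions_append (χ : List ℕ → Bool) (k : ℕ) {col : Bool} {q l : List ℕ}
    (hq : WindowsMono χ k col q) :
    q.length - k + (goodPositions χ k l).card ≤ (goodPositions χ k (q ++ l)).card := by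
  classical
  have hwin : ∀ s, s + k ≤ q.length → χ (((q ++ l).drop s).take k) = col := by
    intro s hs
    rw [List.drop_append_of_le_length (by omega), List.take_append_of_le_length (by simp; omega)]
    refine hq (q.take s) _ ((q.drop s).drop k) ?_ (by simp; omega)
    rw [List.append_assoc, List.take_append_drop, List.take_append_drop]
  have hdisj : Disjoint (Finset.range (q.length - k))
      ((goodPositions χ k l).map (addLeftEmbedding q.length)) := by
    rw [Finset.disjoint_left]
    intro s hs hs'
    obtain ⟨r, -, rfl⟩ := Finset.mem_map.1 hs'
    have := Finset.mem_range.1 hs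
    simp at this
    omega
  calc _ = (Finset.range (q.length - k) ∪
        (goodPositions χ k l).map (addLeftEmbedding q.length)).card := by
        rw [Finset.card_union_of_disjoint hdisj, Finset.card_range, Finset.card_map]
    _ ≤ _ := Finset.card_le_card ?_
  intro s hs
  rcases Finset.mem_union.1 hs with hs | hs
  · have hs := Finset.mem_range.1 hs
    simp only [goodPositions, Finset.mem_filter, Finset.mem_range, List.length_append]
    exact ⟨by omega, by omega, by rw [hwin s (by omega), hwin (s + 1) (by omega)]⟩
  · obtain ⟨r, hr, rfl⟩ := Finset.mem_map.1 hs
    simp only [goodPositions, Finset.mem_filter, Finset.mem_range] at hr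
    simp only [goodPositions, Finset.mem_filter, Finset.mem_range, List.length_append,
      addLeftEmbedding_apply, add_assoc, List.drop_length_add_append]
    exact ⟨by omega, by omega, hr.2.2⟩

/-- Each monochromatic block of `L + k` entries loses at most `k + 1` positions, a fraction `(k + 1)
/ (L + k)`; the leftover set, too small to contain a guaranteed block, loses at most `tower k (2 *
L)`. -/
theorem exists_list_many_goodPositions (χ : List ℕ → Bool) (k L : ℕ) (hL : 0 < L) (R : Finset ℕ) :
    ∃ l : List ℕ, l.Nodup ∧ l.toFinset = R ∧
      (L + k) * R.card ≤ (L + k) * (goodPositions χ (k + 1) l).card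
        + (L + k) * tower k (2 * L) + (k + 1) * R.card := by
  classical
  induction R using Finset.strongInduction with
  | H R ih =>
    rcases le_or_gt R.card (tower k (2 * L)) with h | h
    · exact ⟨R.toList, R.nodup_toList, R.toList_toFinset, by nlinarith⟩
    · obtain ⟨q, hq, hsort, hqR, col, hmono⟩ := exists_windowsMono χ R k L hL h
      have hnd : q.Nodup := hsort.imp fun h => h.ne
      have hsub : q.toFinset ⊆ R := fun x hx => hqR x (List.mem_toFinset.1 hx)
      have hcard : q.toFinset.card = L + k := by rw [List.toFinset_card_of_nodup hnd, hq]
      have hcard' := Finset.card_sdiff_add_card_eq_card hsub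
      obtain ⟨l, hl, hlR, hgood⟩ := ih (R \ q.toFinset)
        (Finset.sdiff_ssubset hsub (Finset.card_pos.1 (by omega)))
      refine ⟨q ++ l, List.nodup_append'.2 ⟨hnd, hl, ?_⟩, ?_, ?_⟩
      · intro x hx hx'
        have := List.mem_toFinset.2 hx'
        rw [hlR, Finset.mem_sdiff] at this
        exact this.2 (List.mem_toFinset.2 hx)
      · rw [List.toFinset_append, hlR, Finset.union_sdiff_of_subset hsub]
      · have h1 := card_goodPositions_append χ (k + 1) (l := l) hmono
        rw [hq] at h1
        have h3 : L + (goodPositions χ (k + 1) l).card ≤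
            (goodPositions χ (k + 1) (q ++ l)).card + 1 := by omega
        rw [hcard] at hcard'
        rw [← hcard']
        generalize (R \ q.toFinset).card = r at *
        nlinarith [Nat.mul_le_mul_left (L + k) h3]

/-! ### Oriented cycles -/

open Fin.CommRing in
theorem fin_add_one_ne_sub_one {m : ℕ} (v : Fin (m + 3)) : v + 1 ≠ v - 1 := by
  intro h
  have h1 : (1 : Fin (m + 3)) + 1 = 0 := by linear_combination h
  have := congrArg Fin.val h1
  simp [Fin.val_add, Nat.mod_eq_of_lt (show 2 < m + 3 by omega)] at this

/-- The neighbours of `v` in the cycle: the successor and the predecessor. -/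
noncomputable def cyclePorts {m : ℕ} (v : Fin (m + 3)) :
    Fin 2 ≃ (SimpleGraph.cycleGraph (m + 3)).neighborSet v :=
  Equiv.ofBijective
    (fun i => ⟨if (i : ℕ) = 0 then v + 1 else v - 1, by
      rw [SimpleGraph.cycleGraph_neighborSet]; split_ifs <;> simp⟩)
    (by
      have hne := fin_add_one_ne_sub_one v
      constructor
      · intro i j hij
        have := congrArg Subtype.val hij
        fin_cases i <;> fin_cases j <;> simp_all [hne.symm]
      · rintro ⟨w, hw⟩
        rw [SimpleGraph.cycleGraph_neighborSet] at hw
        rcases hw with rfl | rfl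
        · exact ⟨1, by simp⟩
        · exact ⟨0, by simp⟩)

theorem ncard_neighborSet_cycleGraph {m : ℕ} (v : Fin (m + 3)) :
    ((SimpleGraph.cycleGraph (m + 3)).neighborSet v).ncard = 2 := by
  rw [← Nat.card_coe_set_eq, ← Nat.card_congr (cyclePorts v), Nat.card_fin]

/-- The cycle with identifiers `f`, in which port `0` of every node leads to its successor and
port `1` to its predecessor. -/
noncomputable def cycleNetwork {m : ℕ} (f : Fin (m + 3) → ℕ) (hf : Function.Injective f) :
    Network (m + 3) where
  graph := SimpleGraph.cycleGraph (m + 3)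
  ident := f
  ident_injective := hf
  port v := (finCongr (ncard_neighborSet_cycleGraph v)).trans (cyclePorts v)

section
variable {m : ℕ} {f : Fin (m + 3) → ℕ} {hf : Function.Injective f}

theorem cycleNetwork_deg (v : Fin (m + 3)) : (cycleNetwork f hf).deg v = 2 :=
  ncard_neighborSet_cycleGraph v

theorem cycleNetwork_neighbor (v : Fin (m + 3)) (i : Fin ((cycleNetwork f hf).deg v)) :
    (cycleNetwork f hf).neighbor v i = if (i : ℕ) = 0 then v + 1 else v - 1 := rfl

theorem cycleNetwork_backPort (v : Fin (m + 3)) (i : Fin ((cycleNetwork f hf).deg v)) :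
    (cycleNetwork f hf).backPort v i = if (i : ℕ) = 0 then 1 else 0 := by
  have key : ∀ (w : Fin (m + 3)) (h : v ∈ (cycleNetwork f hf).graph.neighborSet w)
      (j : Fin 2), (if (j : ℕ) = 0 then w + 1 else w - 1) = v →
      ((((cycleNetwork f hf).port w).symm ⟨v, h⟩ : Fin _) : ℕ) = j := by
    intro w h j hj
    have : ((cycleNetwork f hf).port w).symm ⟨v, h⟩ = (finCongr (cycleNetwork_deg w)).symm j :=
      (Equiv.symm_apply_eq _).2 (Subtype.ext hj.symm)
    rw [this]
    rfl
  unfold Network.backPort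
  split_ifs with h0
  · refine key _ _ 1 ?_
    rw [cycleNetwork_neighbor, if_pos h0]
    simp
  · refine key _ _ 0 ?_
    rw [cycleNetwork_neighbor, if_neg h0]
    simp

end

namespace LocalAlgorithm

/-- The state after `t` rounds of a node of an oriented cycle on `n` nodes, if the identifiers of
the nodes within distance `t` of it are `x 0, …, x (2 * t)`. -/
def cycleState (A : LocalAlgorithm) (n : ℕ) : ℕ → (ℕ → ℕ) → A.State
  | 0, x => A.init n (x 0) 2
  | t + 1, x => A.recv (A.cycleState n t fun j => x (j + 1)) 2 fun i =>
      if (i : ℕ) = 0 then A.send (A.cycleState n t fun j => x (j + 2)) 1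
      else A.send (A.cycleState n t x) 0

theorem cycleState_congr (A : LocalAlgorithm) (n t : ℕ) {x y : ℕ → ℕ}
    (h : ∀ j < 2 * t + 1, x j = y j) : A.cycleState n t x = A.cycleState n t y := by
  induction t generalizing x y with
  | zero => simp [cycleState, h 0]
  | succ t ih =>
    unfold cycleState
    rw [ih (fun j hj => h (j + 1) (by omega)), ih (fun j hj => h (j + 2) (by omega)),
      ih (fun j hj => h j (by omega))]

theorem recv_congr (A : LocalAlgorithm) (s : A.State) {d e : ℕ} (h : d = e) {p : Fin d → A.Msg}
    {q : Fin e → A.Msg} (hpq : ∀ i, p i = q (Fin.cast h i)) : A.recv s d p = A.recv s e q := by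
  subst h
  congr 1
  funext i
  exact hpq i

/-- The window starts at `s` and its centre is `s + t`; indices are taken mod `m + 3`, so it may
wrap around the cycle. -/
theorem stateAfter_cycleNetwork (A : LocalAlgorithm) {m : ℕ} {f : Fin (m + 3) → ℕ}
    {hf : Function.Injective f} (t s : ℕ) :
    A.stateAfter (cycleNetwork f hf) t (Fin.ofNat (m + 3) (s + t)) =
      A.cycleState (m + 3) t fun j => f (Fin.ofNat (m + 3) (s + j)) := by
  have hsucc : ∀ a : ℕ, Fin.ofNat (m + 3) a + 1 = Fin.ofNat (m + 3) (a + 1) := by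
    intro a
    ext
    simp [Fin.val_add]
  induction t generalizing s with
  | zero =>
    unfold stateAfter cycleState
    rw [cycleNetwork_deg]
    rfl
  | succ t ih =>
    unfold stateAfter cycleState
    have h1 : (fun j => f (Fin.ofNat (m + 3) (s + (j + 1)))) =
        fun j => f (Fin.ofNat (m + 3) (s + 1 + j)) := by
      funext j; rw [add_right_comm, add_assoc]
    have h2 : (fun j => f (Fin.ofNat (m + 3) (s + (j + 2)))) =
        fun j => f (Fin.ofNat (m + 3) (s + 2 + j)) := by
      funext j; rw [add_right_comm, add_assoc]
    rw [h1, h2, ← ih, ← ih, ← ih, show s + (t + 1) = s + 1 + t by omega]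
    refine A.recv_congr _ (cycleNetwork_deg _) fun i => ?_
    rw [cycleNetwork_backPort, cycleNetwork_neighbor, Fin.val_cast]
    split_ifs with h0
    · rw [hsucc, show s + 1 + t + 1 = s + 2 + t by omega]
    · rw [show s + 1 + t = s + t + 1 by omega, ← hsucc, add_sub_cancel_right]

end LocalAlgorithm

/-! ### Cuts of cycles and the lower bound -/

theorem cutSize_cycleGraph_le {m : ℕ} (side : Fin (m + 3) → Bool) :
    cutSize (SimpleGraph.cycleGraph (m + 3)) side ≤
      (Finset.univ.filter fun v => side v ≠ side (v + 1)).card := by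
  classical
  have hsub : {e : Sym2 (Fin (m + 3)) | e ∈ (SimpleGraph.cycleGraph (m + 3)).edgeSet ∧
      ∃ u v, e = s(u, v) ∧ side u ≠ side v} ⊆
      (((Finset.univ.filter fun v => side v ≠ side (v + 1)).image fun v => s(v, v + 1) :
        Finset (Sym2 (Fin (m + 3)))) : Set (Sym2 (Fin (m + 3)))) := by
    rintro e ⟨he, u, v, rfl, huv⟩
    rw [SimpleGraph.mem_edgeSet, ← SimpleGraph.mem_neighborSet,
      SimpleGraph.cycleGraph_neighborSet] at he
    rw [Finset.mem_coe, Finset.mem_image]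
    rcases he with rfl | rfl
    · exact ⟨u - 1, by simpa using huv.symm, by simp [Sym2.eq_swap]⟩
    · exact ⟨u, by simpa using huv, rfl⟩
  unfold cutSize
  refine (Set.ncard_le_ncard hsub (Finset.finite_toSet _)).trans ?_
  rw [Set.ncard_coe_finset]
  exact Finset.card_image_le

/-- Alternating sides by parity cuts every edge except possibly the closing one. -/
theorem le_maxCut_cycleGraph (m : ℕ) : m + 2 ≤ maxCut (SimpleGraph.cycleGraph (m + 3)) := by
  let side : Fin (m + 3) → Bool := fun v => decide ((v : ℕ) % 2 = 0)
  refine le_trans ?_ (Finset.le_sup (f := cutSize _) (Finset.mem_univ side))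
  have hinj : Function.Injective fun i : Fin (m + 2) => s(i.castSucc, i.succ) := by
    intro i j hij
    rcases Sym2.eq_iff.1 hij with h | h
    · exact Fin.castSucc_injective _ h.1
    · have h1 := congrArg Fin.val h.1
      have h2 := congrArg Fin.val h.2
      simp at h1 h2
      omega
  have hsub : Set.range (fun i : Fin (m + 2) => s(i.castSucc, i.succ)) ⊆
      {e : Sym2 (Fin (m + 3)) | e ∈ (SimpleGraph.cycleGraph (m + 3)).edgeSet ∧
        ∃ u v, e = s(u, v) ∧ side u ≠ side v} := by
    rintro _ ⟨i, rfl⟩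
    refine ⟨?_, _, _, rfl, ?_⟩
    · rw [SimpleGraph.mem_edgeSet, ← SimpleGraph.mem_neighborSet,
        SimpleGraph.cycleGraph_neighborSet]
      right
      simp
    · simp only [side, Fin.val_castSucc, Fin.val_succ, ne_eq, decide_eq_decide]
      omega
  have hle := Set.ncard_le_ncard hsub (Set.toFinite _)
  rwa [Set.ncard_range_of_injective hinj, Nat.card_fin] at hle

/-- With `l` written around the cycle, distinct good positions give distinct uncut edges. The
defaults `0` and `false` play no role there: the windows are full and the nodes have output. -/
theorem card_goodPositions_le_of_approximatesMaxCut {B T : ℕ → ℕ} {A : LocalAlgorithm} {α : ℝ}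
    (hA : A.ApproximatesMaxCut B T α) (hα : 0 < α) {m : ℕ} (hB : m + 3 ≤ B (m + 3)) {l : List ℕ}
    (hl : l.Nodup) (hlR : l.toFinset = Finset.Icc 1 (m + 3)) :
    α * (m + 2) + (goodPositions (fun w => (A.output (A.cycleState (m + 3) (T (m + 3))
      fun j => w.getD j 0)).getD false) (2 * T (m + 3) + 1) l).card ≤ m + 3 := by
  classical
  set t := T (m + 3) with ht
  have hlen : l.length = m + 3 := by
    rw [← List.toFinset_card_of_nodup hl, hlR, Nat.card_Icc, Nat.add_sub_cancel]
  let f : Fin (m + 3) → ℕ := fun v => l.getD v 0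
  have hget : ∀ v : Fin (m + 3), f v = l[(v : ℕ)]'(by omega) := fun v =>
    List.getD_eq_getElem _ _ _
  have hf : Function.Injective f := by
    intro u v huv
    rw [hget, hget] at huv
    exact Fin.ext ((List.Nodup.getElem_inj_iff hl).1 huv)
  obtain ⟨side, hside, hcut⟩ := hA (m + 3) (cycleNetwork f hf) (by
    intro v
    have : f v ∈ l.toFinset := by rw [hget]; simp
    rw [hlR, Finset.mem_Icc] at this
    exact ⟨this.1, this.2.trans hB⟩)
  have hwin : ∀ s, s + (2 * t + 1) ≤ m + 3 → side (Fin.ofNat (m + 3) (s + t)) =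
      (A.output (A.cycleState (m + 3) t
        fun j => ((l.drop s).take (2 * t + 1)).getD j 0)).getD false := by
    intro s hs
    have h1 := hside (Fin.ofNat (m + 3) (s + t))
    rw [LocalAlgorithm.stateAfter_cycleNetwork] at h1
    rw [A.cycleState_congr (m + 3) t (y := fun j => f (Fin.ofNat (m + 3) (s + j))), ← ht.symm, h1]
    · rfl
    · intro j hj
      simp only [f, Fin.val_ofNat]
      rw [Nat.mod_eq_of_lt (by omega)]
      simp [List.getD_eq_getElem?_getD, hj]
  have hgood : (goodPositions (fun w => (A.output (A.cycleState (m + 3) t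
      fun j => w.getD j 0)).getD false) (2 * t + 1) l).card ≤
      (Finset.univ.filter fun v => side v = side (v + 1)).card := by
    refine Finset.card_le_card_of_injOn (fun s => Fin.ofNat (m + 3) (s + t)) ?_ ?_
    · intro s hs
      simp only [goodPositions, Finset.coe_filter, Finset.mem_range, Set.mem_ofPred_eq, hlen] at hs
      have hsucc : Fin.ofNat (m + 3) (s + t) + 1 = Fin.ofNat (m + 3) (s + 1 + t) := by
        ext
        simp [Fin.val_add, add_right_comm]
      simp only [Finset.coe_filter, Finset.mem_univ, true_and, Set.mem_ofPred_eq]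
      rw [hsucc, hwin s (by omega), hwin (s + 1) (by omega)]
      exact hs.2.2
    · intro s hs r hr h
      simp only [goodPositions, Finset.coe_filter, Finset.mem_range, Set.mem_ofPred_eq, hlen] at hs hr
      have := congrArg Fin.val h
      simp only [Fin.val_ofNat] at this
      rw [Nat.mod_eq_of_lt (by omega), Nat.mod_eq_of_lt (by omega)] at this
      omega
  have hsum := Finset.card_filter_add_card_filter_not (s := (Finset.univ : Finset (Fin (m + 3))))
    (fun v => side v = side (v + 1))
  rw [Finset.card_univ, Fintype.card_fin] at hsum
  have hle := cutSize_cycleGraph_le side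
  have hmax := le_maxCut_cycleGraph m
  have h1 : cutSize (SimpleGraph.cycleGraph (m + 3)) side + (goodPositions (fun w => (A.output
      (A.cycleState (m + 3) t fun j => w.getD j 0)).getD false) (2 * t + 1) l).card ≤ m + 3 := by
    simp only [ne_eq] at hle
    omega
  have h2 : α * (m + 2) ≤ α * (maxCut (SimpleGraph.cycleGraph (m + 3)) : ℝ) :=
    mul_le_mul_of_nonneg_left (by exact_mod_cast hmax) hα.le
  have h3 : ((cutSize (SimpleGraph.cycleGraph (m + 3)) side : ℕ) : ℝ) + (goodPositions (fun w =>
      (A.output (A.cycleState (m + 3) t fun j => w.getD j 0)).getD false) (2 * t + 1) l).card ≤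
      m + 3 := by exact_mod_cast h1
  have h4 : α * (maxCut (SimpleGraph.cycleGraph (m + 3)) : ℝ) ≤
    (cutSize (SimpleGraph.cycleGraph (m + 3)) side : ℝ) := hcut
  linarith

theorem lt_mul_tower_of_approximatesMaxCut {B T : ℕ → ℕ} {A : LocalAlgorithm} {α : ℝ}
    (hA : A.ApproximatesMaxCut B T α) (hα : 0 < α) {K : ℕ} (hK : 4 < α * K) {n : ℕ} (hn : 3 ≤ n)
    (hB : n ≤ B n) : n < K * tower (2 * T n) (2 * (K * (2 * T n + 1))) := by
  obtain ⟨m, rfl⟩ := Nat.exists_eq_add_of_le' hn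
  by_contra hM
  rw [not_lt] at hM
  have hK0 : 0 < K := by
    rcases Nat.eq_zero_or_pos K with rfl | h
    · norm_num at hK
    · exact h
  set t := T (m + 3) with ht
  -- The choice `L = K * (2 * t + 1)` makes the lost fraction `(2 * t + 1) / (L + 2 * t)` at most `1
  -- / K`.
  obtain ⟨l, hl, hlR, hgood⟩ := exists_list_many_goodPositions (fun w => (A.output
    (A.cycleState (m + 3) t fun j => w.getD j 0)).getD false) (2 * t) (K * (2 * t + 1))
    (by positivity) (Finset.Icc 1 (m + 3))
  have hcut := card_goodPositions_le_of_approximatesMaxCut hA hα hB hl hlR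
  rw [← ht] at hcut
  rw [Nat.card_Icc, Nat.add_sub_cancel] at hgood
  generalize (goodPositions (fun w => (A.output (A.cycleState (m + 3) t
    fun j => w.getD j 0)).getD false) (2 * t + 1) l).card = g at hgood hcut
  generalize tower (2 * t) (2 * (K * (2 * t + 1))) = M at hgood hM
  have hgood' : ((K : ℝ) * (2 * t + 1) + 2 * t) * (m + 3) ≤ (K * (2 * t + 1) + 2 * t) * g +
      (K * (2 * t + 1) + 2 * t) * M + (2 * t + 1) * (m + 3) := by exact_mod_cast hgood
  have hM' : (K : ℝ) * M ≤ m + 3 := by exact_mod_cast hM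
  have hKr : (0 : ℝ) < K := by exact_mod_cast hK0
  have ht0 : (0 : ℝ) ≤ t := Nat.cast_nonneg t
  have hm0 : (0 : ℝ) ≤ m := Nat.cast_nonneg m
  -- the number of bad positions is at most `M + (m + 3) / K`
  have hD : (0 : ℝ) < K * (2 * t + 1) + 2 * t := by positivity
  have h1 : (K : ℝ) * ((m + 3) - g - M) ≤ m + 3 := by
    have h2 : (K * (2 * t + 1) + 2 * t) * (((m : ℝ) + 3) - g - M) ≤ (2 * t + 1) * (m + 3) := by
      linarith
    refine le_of_mul_le_mul_left ?_ hD
    calc _ = K * ((K * (2 * t + 1) + 2 * t) * (((m : ℝ) + 3) - g - M)) := by ring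
      _ ≤ K * ((2 * t + 1) * (m + 3)) := mul_le_mul_of_nonneg_left h2 hKr.le
      _ ≤ _ := by nlinarith [mul_nonneg ht0 (by linarith : (0 : ℝ) ≤ m + 3)]
  have h3 : (K : ℝ) * (α * (m + 2)) ≤ 2 * (m + 3) := by
    have := mul_le_mul_of_nonneg_left hcut hKr.le
    linarith
  -- With `α * K > 4`, `h3` would give `4 * (m + 2) < 2 * (m + 3)`.
  nlinarith

theorem logStar_le_of_approximatesMaxCut {B T : ℕ → ℕ} {A : LocalAlgorithm} {α : ℝ}
    (hA : A.ApproximatesMaxCut B T α) (hα : 0 < α) {K : ℕ} (hK : 4 < α * K) {n : ℕ} (hn : 3 ≤ n)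
    (hB : n ≤ B n) : logStar n ≤ 2 * T n + 2 * K ^ 2 * (2 * T n + 1) := by
  have h := lt_mul_tower_of_approximatesMaxCut hA hα hK hn hB
  have hK0 : 1 ≤ K := by
    rcases Nat.eq_zero_or_pos K with rfl | h
    · norm_num at hK
    · exact h
  rw [logStar_le_iff, Nat.cast_le, tower_add]
  calc n ≤ _ := h.le
    _ ≤ _ := mul_tower_le hK0 (by nlinarith) _
    _ ≤ _ := tower_mono _ ((le_of_eq (by ring)).trans (le_tower_one _))

/-- For every approximation ratio `α > 0` there are `c > 0` and `N`, depending on `α` only, such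
that every deterministic LOCAL `α`-approximation algorithm for MaxCut on general graphs, with
identifiers from `{1, …, B n}` for any `B n ≥ n` (in particular for any polynomial range), needs at
least `c * log* n` rounds on `n`-vertex graphs, for all `n ≥ N`. -/
theorem corollary2p3 (α : ℝ) (hα : 0 < α) :
    ∃ c : ℝ, 0 < c ∧ ∃ N : ℕ,
      ∀ (B : ℕ → ℕ), (∀ n, n ≤ B n) →
      ∀ (A : LocalAlgorithm) (T : ℕ → ℕ), A.ApproximatesMaxCut B T α →
      ∀ n : ℕ, N ≤ n → c * (logStar (n : ℝ) : ℝ) ≤ (T n : ℝ) := by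
  obtain ⟨K, hK⟩ := exists_nat_gt (4 / α)
  rw [div_lt_iff₀' hα] at hK
  -- The additive term `2 * K ^ 2` is absorbed into half of `log* n`, which exceeds it once `n >
  -- tower (4 * K ^ 2) 1`; the `+ 3` ensures that the cycle exists.
  refine ⟨1 / (2 * (2 + 4 * K ^ 2)), by positivity, tower (4 * K ^ 2) 1 + 3, ?_⟩
  intro B hB A T hA n hn
  have h1 := logStar_le_of_approximatesMaxCut hA hα hK (by omega) (hB n)
  have h2 : 4 * K ^ 2 < logStar n := by
    rw [← not_le, logStar_le_iff, Nat.cast_le]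
    omega
  have h1' : (logStar n : ℝ) ≤ 2 * T n + 2 * K ^ 2 * (2 * T n + 1) := by exact_mod_cast h1
  have h2' : 4 * (K : ℝ) ^ 2 < logStar n := by exact_mod_cast h2
  rw [one_div_mul_eq_div, div_le_iff₀ (by positivity)]
  linarith
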